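/- Let $(Z,A),(Z_1,A_1),(Z_2,A_2),\dots$ be identically distributed random pairs with values in $\{0,1\}\times\{0,1\}$, with $(Z_1,A_1),(Z_2,A_2),\dots$ independent, and assume $E(ZA)>0$. Write $E_nf(Z,A)=n^{-1}\sum_{i=1}^n f(Z_i,A_i)$. For $a,b>0$ put $$\tau(a,b)=\frac{E(ZA)}{E(ZA)+aE(A(1-Z))+bE(Z(1-A))},\qquad \tau_n(a,b)=\frac{E_n(ZA)}{E_n(ZA)+aE_n(A(1-Z))+bE_n(Z(1-A))}$$ (the Tversky index and its empirical version, with $0/0=0$ in the latter), and $$\nu(a,b)=\frac{[\tau(a^2,b^2)]^{-1}-1+\{[\tau(a,b)]^{-1}-1\}^2}{E(ZA)\,[\tau(a,b)]^{-4}}.$$ For $m>0$, $m\neq 1$, let $c=1/(1-m)$, $\tau_\pm=(3+2c\pm\sqrt{4c^2-4c+9})/8$, $\tau_o=\tau_-I(c>1)+\tau_+I(c<0)$ and $V(m)=\tau_o(1-\tau_o)(1-\tau_o/c)^2$; for $m=1$, read $c=\infty$, $1/c=0$, $\tau_o=1/2$, so that $V(1)=1/4$. The F-beta measure is a special case of the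 Tversky index: for every $\beta>0$, with $prec=P(Z=1\mid A=1)$ and $rec=P(A=1\mid Z=1)$, $$\frac{1+\beta^2}{1/prec+\beta^2/rec}=\tau\Big(\frac1{1+\beta^2},\frac{\beta^2}{1+\beta^2}\Big).$$ Moreover, for all $a,b>0$: (i) $\nu(a,b)\ge 0$, and $\sqrt n\,(\tau_n(a,b)-\tau(a,b))$ converges in distribution to $N(0,\nu(a,b))$ as $n\to\infty$ (the point mass at $0$ if $\nu(a,b)=0$). (ii) For every prediction rule $A'$ (a $\{0,1\}$-valued random variable on the same probability space as $Z$, with $E(ZA')>0$), the variance $\nu(a,b)$ computed from $(Z,A')$ satisfies $$\nu(a,b)\le\frac{V(\max\{a,b\})}{b\,EZ}.$$ Here, with $m=\max\{a,b\}$ and the corresponding $c$, the point $\tau_o$ lies in $(0,1)$ and $V(m)$ is the maximum of $t(1-t)(1-t/c)^2$ over $t\in[0,1]$, attained at $t=\tau_o$. (iii) The values of $V(0.5),V(0.6),V(0.7),V(0.8),V(0.9)$ are $0.1549,\ 0.1695,\ 0.1861,\ 0.2050,\ 0.2262$ respectively, each up to an error of at most $5\cdot 10^{-5}$. -/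

import Mathlib

open MeasureTheory ProbabilityTheory Filter Topology

noncomputable section

/-- The Tversky ratio `x / (x + a u + b v)`, where `x`, `u`, `v` stand for the (true or empirical)
means of `Z A`, `A (1 - Z)` and `Z (1 - A)`. -/
def tverskyRatio (a b x u v : ℝ) : ℝ := x / (x + a * u + b * v)

/-- The population Tversky index `τ(a, b)`. -/
def tverskyIndex {Ω : Type*} [MeasurableSpace Ω] (P : Measure Ω) (Z A : Ω → ℝ) (a b : ℝ) : ℝ :=
  tverskyRatio a b (∫ ω, Z ω * A ω ∂P) (∫ ω, A ω * (1 - Z ω) ∂P) (∫ ω, Z ω * (1 - A ω) ∂P)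

/-- The sample average `E_n f(Z, A)` over the first `n` pairs. -/
def sampleMean {Ω : Type*} (Zs As : ℕ → Ω → ℝ) (n : ℕ) (f : ℝ → ℝ → ℝ) (ω : Ω) : ℝ :=
  (n : ℝ)⁻¹ * ∑ i ∈ Finset.range n, f (Zs i ω) (As i ω)

/-- The empirical Tversky index `τ_n(a, b)`. (Where it reads `0 / 0`, its value is `0`.) -/
def empiricalTversky {Ω : Type*} (Zs As : ℕ → Ω → ℝ) (a b : ℝ) (n : ℕ) (ω : Ω) : ℝ :=
  tverskyRatio a b (sampleMean Zs As n (fun z y => z * y) ω)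
    (sampleMean Zs As n (fun z y => y * (1 - z)) ω)
    (sampleMean Zs As n (fun z y => z * (1 - y)) ω)

/-- The asymptotic variance `ν(a, b)`. -/
def tverskyVariance {Ω : Type*} [MeasurableSpace Ω] (P : Measure Ω) (Z A : Ω → ℝ)
    (a b : ℝ) : ℝ :=
  ((tverskyIndex P Z A (a ^ 2) (b ^ 2))⁻¹ - 1 + ((tverskyIndex P Z A a b)⁻¹ - 1) ^ 2) /
    ((∫ ω, Z ω * A ω ∂P) * ((tverskyIndex P Z A a b)⁻¹) ^ 4)

/-- Precision `P(Z = 1 | A = 1)`. -/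
def precision {Ω : Type*} [MeasurableSpace Ω] (P : Measure Ω) (Z A : Ω → ℝ) : ℝ :=
  (cond P {ω | A ω = 1}).real {ω | Z ω = 1}

/-- Recall `P(A = 1 | Z = 1)`. -/
def recallRate {Ω : Type*} [MeasurableSpace Ω] (P : Measure Ω) (Z A : Ω → ℝ) : ℝ :=
  (cond P {ω | Z ω = 1}).real {ω | A ω = 1}

/-- The F-beta measure. -/
def fBeta {Ω : Type*} [MeasurableSpace Ω] (P : Measure Ω) (Z A : Ω → ℝ) (β : ℝ) : ℝ :=
  (1 + β ^ 2) / (1 / precision P Z A + β ^ 2 / recallRate P Z A)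

/-- The constant `c = 1 / (1 - m)`, used for `m ≠ 1` only. -/
def tverskyC (m : ℝ) : ℝ := 1 / (1 - m)

/-- The function `t ↦ t (1 - t) (1 - t / c)²` with `c = 1 / (1 - m)`; for `m = 1` one has `c = ∞`
and `1 / c = 0`. -/
def boundFun (m t : ℝ) : ℝ :=
  if m = 1 then t * (1 - t) else t * (1 - t) * (1 - t / tverskyC m) ^ 2

/-- `τ₋ = (3 + 2c - √(4c² - 4c + 9)) / 8`. -/
def tauMinus (c : ℝ) : ℝ := (3 + 2 * c - √(4 * c ^ 2 - 4 * c + 9)) / 8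

/-- `τ₊ = (3 + 2c + √(4c² - 4c + 9)) / 8`. -/
def tauPlus (c : ℝ) : ℝ := (3 + 2 * c + √(4 * c ^ 2 - 4 * c + 9)) / 8

open Classical in
/-- `τ_o = τ₋ I(c > 1) + τ₊ I(c < 0)` with `c = 1 / (1 - m)`; for `m = 1`, where `c = ∞`, it is the
limiting value `1 / 2`. -/
def tauOpt (m : ℝ) : ℝ :=
  if m = 1 then 1 / 2
  else tauMinus (tverskyC m) * (if 1 < tverskyC m then 1 else 0) +
    tauPlus (tverskyC m) * (if tverskyC m < 0 then 1 else 0)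

/-- `V(m) = τ_o (1 - τ_o) (1 - τ_o / c)²`. -/
def boundV (m : ℝ) : ℝ := boundFun m (tauOpt m)

end

/-!
All assertions rest on clearing denominators. Put `x = E(ZA)`, `u = E(A(1 - Z))`,
`v = E(Z(1 - A))`, `s = a u + b v` and `D = x + s`, so that `τ = τ(a, b) = x / D` and
`ν(a, b) = x ((a² u + b² v) x + s²) / D⁴` (`tverskyVariance_eq`). Likewise precision is
`x / (x + u)` and recall is `x / (x + v)`, which identifies the F-beta measure.

*Asymptotic normality.* `τ_n(a, b)` is a ratio of two sums of i.i.d. bounded variables, and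
`τ_n - τ = ∑ (Fᵢ - τ Gᵢ) / ∑ Gᵢ` with `F = ZA` and `G = ZA + a A(1 - Z) + b Z(1 - A)`. The summands
of the numerator are centred, so the central limit theorem, the strong law for `∑ Gᵢ / n` and
Slutsky's theorem give the limit `N(0, Var(F - τ G) / D²)`; this is
`tendstoInDistribution_sqrt_mul_ratio_sub`. The products `ZA`, `A(1 - Z)`, `Z(1 - A)` are indicators
of disjoint events, whence `Var(F - τ G) = (1 - τ)² x + τ² (a² u + b² v)`, and the limiting variance
is `ν(a, b)` (`variance_div_sq_eq_tverskyVariance`).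

*The bound.* With `m = max a b`, the inequalities `a² u + b² v ≤ m s` and `b (x + v) ≤ s + m x` give
`b EZ ν(a, b) ≤ τ (1 - τ) (1 - (1 - m) τ)²` (`tverskyVariance_le`), and `V(m)` is the maximum of
the right-hand side over `τ ∈ [0, 1]`: the derivative of `t (1 - t) (1 - k t)²`, with `k = 1 - m`,
is `(1 - k t) (1 - (2 + 3k) t + 4k t²)`, and it changes sign on `[0, 1]` only at the root `τ_o`
(`tauOpt_spec`, `mul_one_sub_mul_sq_le_of_root`). The values of `V` follow from rational enclosures
of the square root in `τ₋`.
-/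

/-! ### The critical point and the maximum of `t (1 - t) (1 - t / c)²` -/

/-- The case `m = 1` of `boundFun` merges with the others when `1 / c` is written as `1 - m`. -/
lemma boundFun_eq (m t : ℝ) : boundFun m t = t * (1 - t) * (1 - (1 - m) * t) ^ 2 := by
  unfold boundFun tverskyC
  split_ifs with h
  · subst h; ring
  · rw [div_div_eq_mul_div, div_one, mul_comm t (1 - m)]

lemma tauOpt_of_lt_one {m : ℝ} (h0 : 0 < m) (h1 : m < 1) :
    tauOpt m = tauMinus (tverskyC m) := by
  have hc : 1 < tverskyC m := by
    unfold tverskyC; rw [lt_div_iff₀ (by linarith)]; linarith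
  simp [tauOpt, h1.ne, hc, (zero_lt_one.trans hc).not_gt]

lemma tauOpt_of_one_lt {m : ℝ} (h1 : 1 < m) : tauOpt m = tauPlus (tverskyC m) := by
  have hc : tverskyC m < 0 := by
    unfold tverskyC; exact div_neg_of_pos_of_neg one_pos (by linarith)
  simp [tauOpt, h1.ne', hc, (hc.trans zero_lt_one).not_gt]

/-- `τ_o` lies in `(0, 1)` and is a root of the quadratic factor `1 - (2 + 3k) t + 4k t²` of the
derivative of `t (1 - t) (1 - k t)²`, where `k = 1 - m`. -/
lemma tauOpt_spec {m : ℝ} (hm : 0 < m) :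
    tauOpt m ∈ Set.Ioo (0 : ℝ) 1 ∧
      1 - (2 + 3 * (1 - m)) * tauOpt m + 4 * (1 - m) * tauOpt m ^ 2 = 0 := by
  rcases eq_or_ne m 1 with rfl | h1
  · norm_num [tauOpt]
  have hk : (1 - m) * tverskyC m = 1 := mul_one_div_cancel (sub_ne_zero.2 h1.symm)
  set c := tverskyC m with hc
  have hs0 : 0 ≤ √(4 * c ^ 2 - 4 * c + 9) := Real.sqrt_nonneg _
  have hs : √(4 * c ^ 2 - 4 * c + 9) ^ 2 = 4 * c ^ 2 - 4 * c + 9 :=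
    Real.sq_sqrt (by nlinarith [sq_nonneg (2 * c - 1)])
  rcases lt_or_gt_of_ne h1 with h | h
  · rw [tauOpt_of_lt_one hm h, ← hc]
    have hc1 : 1 < c := by
      rw [hc, tverskyC, lt_div_iff₀ (by linarith)]; linarith
    unfold tauMinus
    generalize √(4 * c ^ 2 - 4 * c + 9) = s at *
    refine ⟨⟨?_, ?_⟩, ?_⟩
    · have : s < 2 * c + 3 := lt_of_pow_lt_pow_left₀ 2 (by linarith) (by rw [hs]; nlinarith)
      linarith
    · have : 2 * c - 5 < s := lt_of_pow_lt_pow_left₀ 2 hs0 (by rw [hs]; nlinarith)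
      linarith
    · linear_combination (1 - m) / 16 * hs - (1 - (3 + 2 * c - s) / 4) * hk
  · rw [tauOpt_of_one_lt h, ← hc]
    have hc1 : c < 0 := by
      rw [hc, tverskyC]; exact div_neg_of_pos_of_neg one_pos (by linarith)
    unfold tauPlus
    generalize √(4 * c ^ 2 - 4 * c + 9) = s at *
    refine ⟨⟨?_, ?_⟩, ?_⟩
    · have : -(2 * c + 3) < s := lt_of_pow_lt_pow_left₀ 2 hs0 (by rw [hs]; nlinarith)
      linarith
    · have : s < 5 - 2 * c := lt_of_pow_lt_pow_left₀ 2 (by linarith) (by rw [hs]; nlinarith)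
      linarith
    · linear_combination (1 - m) / 16 * hs - (1 - (3 + 2 * c + s) / 4) * hk

/-- A root in `(0, 1)` of the quadratic factor of the derivative maximizes `t (1 - t) (1 - k t)²`
on `[0, 1]`: the other root `1 / (4 k t₀)` lies outside `[0, 1]`, so that the derivative changes
sign only at `t₀`. -/
lemma mul_one_sub_mul_sq_le_of_root {k t₀ t : ℝ} (hk : k < 1) (h₀ : t₀ ∈ Set.Ioo (0 : ℝ) 1)
    (hroot : 1 - (2 + 3 * k) * t₀ + 4 * k * t₀ ^ 2 = 0) (ht : t ∈ Set.Icc (0 : ℝ) 1) :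
    t * (1 - t) * (1 - k * t) ^ 2 ≤ t₀ * (1 - t₀) * (1 - k * t₀) ^ 2 := by
  obtain ⟨h0, h1⟩ := h₀
  have hd (x : ℝ) : HasDerivAt (fun x : ℝ => x * (1 - x) * (1 - k * x) ^ 2)
      ((1 - k * x) * (1 - (2 + 3 * k) * x + 4 * k * x ^ 2)) x := by
    have := ((hasDerivAt_id x).mul ((hasDerivAt_id x).const_sub 1)).mul
      ((((hasDerivAt_id x).const_mul k).const_sub 1).pow 2)
    refine this.congr_deriv ?_
    simp only [id_eq, Pi.mul_apply, Pi.pow_apply]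
    ring
  have hcont : Continuous fun x : ℝ => x * (1 - x) * (1 - k * x) ^ 2 := by fun_prop
  have hlin {x : ℝ} (hx0 : 0 ≤ x) (hx1 : x ≤ 1) : 0 ≤ 1 - k * x := by nlinarith
  -- the quadratic factor times `t₀` is `(x - t₀) (4 k t₀ x - 1)`
  have hfac (x : ℝ) : t₀ * (1 - (2 + 3 * k) * x + 4 * k * x ^ 2) =
      (x - t₀) * (4 * k * t₀ * x - 1) := by linear_combination x * hroot
  have hneg {x : ℝ} (hx0 : 0 ≤ x) (hx1 : x ≤ 1) : 4 * k * t₀ * x - 1 ≤ 0 := by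
    have h : (1 - t₀) * (4 * k * t₀ - 1) = t₀ * (k - 1) := by linear_combination - hroot
    have : 4 * k * t₀ - 1 ≤ 0 := by
      by_contra! hcon
      nlinarith [mul_pos (sub_pos.2 h1) hcon, mul_pos h0 (sub_pos.2 hk)]
    nlinarith
  have hmono : MonotoneOn (fun x : ℝ => x * (1 - x) * (1 - k * x) ^ 2) (Set.Icc 0 t₀) := by
    refine monotoneOn_of_deriv_nonneg (convex_Icc _ _) hcont.continuousOn
      (fun x _ => (hd x).differentiableAt.differentiableWithinAt) fun x hx => ?_
    rw [interior_Icc] at hx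
    have hx1 : x ≤ 1 := (hx.2.trans h1).le
    rw [(hd x).deriv]
    refine mul_nonneg (hlin hx.1.le hx1) (nonneg_of_mul_nonneg_right ?_ h0)
    rw [hfac]
    exact mul_nonneg_of_nonpos_of_nonpos (by linarith [hx.2]) (hneg hx.1.le hx1)
  have hanti : AntitoneOn (fun x : ℝ => x * (1 - x) * (1 - k * x) ^ 2) (Set.Icc t₀ 1) := by
    refine antitoneOn_of_deriv_nonpos (convex_Icc _ _) hcont.continuousOn
      (fun x _ => (hd x).differentiableAt.differentiableWithinAt) fun x hx => ?_
    rw [interior_Icc] at hx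
    have hx0 : 0 ≤ x := (h0.trans hx.1).le
    rw [(hd x).deriv]
    refine mul_nonpos_of_nonneg_of_nonpos (hlin hx0 hx.2.le) (nonpos_of_mul_nonpos_right ?_ h0)
    rw [hfac]
    exact mul_nonpos_of_nonneg_of_nonpos (by linarith [hx.1]) (hneg hx0 hx.2.le)
  rcases le_total t t₀ with h | h
  · exact hmono ⟨ht.1, h⟩ ⟨h0.le, le_rfl⟩ h
  · exact hanti ⟨le_rfl, h1.le⟩ ⟨h, ht.2⟩ h

lemma isMaxOn_boundFun_tauOpt {m : ℝ} (hm : 0 < m) :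
    IsMaxOn (boundFun m) (Set.Icc 0 1) (tauOpt m) := fun t ht => by
  obtain ⟨hmem, hroot⟩ := tauOpt_spec hm
  simp only [Set.mem_ofPred_eq, boundFun_eq]
  exact mul_one_sub_mul_sq_le_of_root (by linarith) hmem hroot ht

/-! ### Numerical values -/

/-- An enclosure `[lo, hi]` of the square root in `τ₋` gives an enclosure of `V(m)`, as the factor
`t` is increasing and the other factors of `t (1 - t) (1 - t / c)²` are decreasing in `t`. -/
lemma boundV_mem_Icc {m c lo hi l u : ℝ} (h0 : 0 < m) (h1 : m < 1) (hc : (1 - m) * c = 1)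
    (hhi0 : 0 ≤ hi) (hlo : lo ^ 2 ≤ 4 * c ^ 2 - 4 * c + 9)
    (hhi : 4 * c ^ 2 - 4 * c + 9 ≤ hi ^ 2) (hl : l = (3 + 2 * c - hi) / 8)
    (hu : u = (3 + 2 * c - lo) / 8) (hl0 : 0 ≤ l) (hu1 : u ≤ 1) :
    boundV m ∈ Set.Icc (l * (1 - u) * (1 - (1 - m) * u) ^ 2)
      (u * (1 - l) * (1 - (1 - m) * l) ^ 2) := by
  have hcm : tverskyC m = c := by
    rw [tverskyC, div_eq_iff (by linarith)]; linarith
  have hlo' : lo ≤ √(4 * c ^ 2 - 4 * c + 9) := Real.le_sqrt_of_sq_le hlo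
  have hhi' : √(4 * c ^ 2 - 4 * c + 9) ≤ hi := Real.sqrt_le_iff.2 ⟨hhi0, hhi⟩
  rw [boundV, boundFun_eq, tauOpt_of_lt_one h0 h1, hcm]
  have hlt : l ≤ tauMinus c := by rw [hl, tauMinus]; linarith
  have htu : tauMinus c ≤ u := by rw [hu, tauMinus]; linarith
  generalize tauMinus c = t at *
  have hk : 0 ≤ 1 - m := by linarith
  have hku : 0 ≤ 1 - (1 - m) * u := by nlinarith
  have hkt : 1 - (1 - m) * u ≤ 1 - (1 - m) * t := by nlinarith
  have hkl : 1 - (1 - m) * t ≤ 1 - (1 - m) * l := by nlinarith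
  have : 0 ≤ t := by linarith
  have : 0 ≤ 1 - t := by linarith
  have : 0 ≤ 1 - u := by linarith
  have : 0 ≤ 1 - l := by linarith
  have : 0 ≤ u := by linarith
  have : 0 ≤ 1 - (1 - m) * t := by linarith
  constructor <;> gcongr

lemma abs_boundV_half_sub_le : |boundV 0.5 - 0.1549| ≤ 0.00005 := by
  have h := boundV_mem_Icc (m := 0.5) (c := 2) (lo := 4.12310562) (hi := 4.12310563)
    (by norm_num) (by norm_num) (by norm_num) (by norm_num) (by norm_num) (by norm_num) rfl rfl
    (by norm_num) (by norm_num)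
  rw [abs_le]
  norm_num at h ⊢
  constructor <;> linarith [h.1, h.2]

lemma abs_boundV_three_fifths_sub_le : |boundV 0.6 - 0.1695| ≤ 0.00005 := by
  have h := boundV_mem_Icc (m := 0.6) (c := 5 / 2) (lo := 4.89897948) (hi := 4.89897949)
    (by norm_num) (by norm_num) (by norm_num) (by norm_num) (by norm_num) (by norm_num) rfl rfl
    (by norm_num) (by norm_num)
  rw [abs_le]
  norm_num at h ⊢
  constructor <;> linarith [h.1, h.2]

lemma abs_boundV_seven_tenths_sub_le : |boundV 0.7 - 0.1861| ≤ 0.00005 := by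
  -- here the radicand is the square of `19 / 3`
  have h := boundV_mem_Icc (m := 0.7) (c := 10 / 3) (lo := 19 / 3) (hi := 19 / 3)
    (by norm_num) (by norm_num) (by norm_num) (by norm_num) (by norm_num) (by norm_num) rfl rfl
    (by norm_num) (by norm_num)
  rw [abs_le]
  norm_num at h ⊢
  constructor <;> linarith

lemma abs_boundV_four_fifths_sub_le : |boundV 0.8 - 0.2050| ≤ 0.00005 := by
  have h := boundV_mem_Icc (m := 0.8) (c := 5) (lo := 9.43398113) (hi := 9.43398114)
    (by norm_num) (by norm_num) (by norm_num) (by norm_num) (by norm_num) (by norm_num) rfl rfl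
    (by norm_num) (by norm_num)
  rw [abs_le]
  norm_num at h ⊢
  constructor <;> linarith [h.1, h.2]

lemma abs_boundV_nine_tenths_sub_le : |boundV 0.9 - 0.2262| ≤ 0.00005 := by
  have h := boundV_mem_Icc (m := 0.9) (c := 10) (lo := 19.20937271) (hi := 19.20937272)
    (by norm_num) (by norm_num) (by norm_num) (by norm_num) (by norm_num) (by norm_num) rfl rfl
    (by norm_num) (by norm_num)
  rw [abs_le]
  norm_num at h ⊢
  constructor <;> linarith [h.1, h.2]

/-! ### A central limit theorem for ratios of sample means -/

/-- Asymptotic normality of a ratio of sums: with `r = f / g = E F / E G`, the error of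
`∑ Fᵢ / ∑ Gᵢ` is `∑ (Fᵢ - r Gᵢ) / ∑ Gᵢ`, to whose numerator the central limit theorem applies and whose
denominator obeys the strong law. Where `∑ Gᵢ` vanishes, the quotient takes the value `0`; almost surely this
happens for finitely many `n` only. -/
theorem tendstoInDistribution_sqrt_mul_ratio_sub {Ω : Type*} [MeasurableSpace Ω] {P : Measure Ω}
    [IsProbabilityMeasure P] {F G : ℕ → Ω → ℝ} {f g v : ℝ}
    (hF : MemLp (F 0) 2 P) (hG : MemLp (G 0) 2 P)
    (hindep : iIndepFun (fun i ω => (F i ω, G i ω)) P)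
    (hident : ∀ i, IdentDistrib (fun ω => (F i ω, G i ω)) (fun ω => (F 0 ω, G 0 ω)) P P)
    (hf : P[F 0] = f) (hg : P[G 0] = g) (hg0 : g ≠ 0)
    (hv : Var[fun ω => F 0 ω - f / g * G 0 ω; P] / g ^ 2 = v) :
    TendstoInDistribution
      (fun (n : ℕ) ω => √(n : ℝ) * ((∑ i ∈ Finset.range n, F i ω) / (∑ i ∈ Finset.range n, G i ω) -
        f / g))
      atTop (id : ℝ → ℝ) (fun _ => P) (gaussianReal 0 v.toNNReal) := by
  set r := f / g with hr
  let W : ℕ → Ω → ℝ := fun i ω => F i ω - r * G i ω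
  have hFm i : AEMeasurable (F i) P := ((hident i).comp measurable_fst).aemeasurable_fst
  have hGm i : AEMeasurable (G i) P := ((hident i).comp measurable_snd).aemeasurable_fst
  have hWmeas : Measurable fun p : ℝ × ℝ => p.1 - r * p.2 := by fun_prop
  have hW2 : MemLp (W 0) 2 P := hF.sub (hG.const_mul r)
  have hW0 : P[W 0] = 0 := by
    have : P[W 0] = f - r * g := by
      rw [← hf, ← hg, ← integral_const_mul]
      exact integral_sub (hF.integrable (by norm_num)) ((hG.integrable (by norm_num)).const_mul r)
    rw [this, hr, div_mul_cancel₀ _ hg0, sub_self]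
  have hclt : TendstoInDistribution (fun (n : ℕ) ω => (√(n : ℝ))⁻¹ * ∑ k ∈ Finset.range n, W k ω)
      atTop (id : ℝ → ℝ) (fun _ => P) (gaussianReal 0 Var[W 0; P].toNNReal) := by
    have := tendstoInDistribution_inv_sqrt_mul_sum_sub (P := P) (X := W)
      (P' := gaussianReal 0 Var[W 0; P].toNNReal) (Y := id) HasLaw.id hW2
      (hindep.comp (fun _ p => p.1 - r * p.2) fun _ => hWmeas) (fun i => (hident i).comp hWmeas)
    simpa [hW0] using this
  have hslln : ∀ᵐ ω ∂P, Tendsto (fun n : ℕ => (∑ i ∈ Finset.range n, G i ω) / n) atTop (𝓝 g) :=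
    hg ▸ strong_law_ae_real G (hG.integrable (by norm_num))
      (fun i j hij => (hindep.indepFun hij).comp measurable_snd measurable_snd)
      (fun i => (hident i).comp measurable_snd)
  have hDm (n : ℕ) : AEMeasurable (fun ω => ((∑ i ∈ Finset.range n, G i ω) / (n : ℝ))⁻¹) P :=
    ((Finset.aemeasurable_fun_sum _ fun i _ => hGm i).div_const _).inv
  have hinv : TendstoInMeasure P (fun (n : ℕ) ω => ((∑ i ∈ Finset.range n, G i ω) / (n : ℝ))⁻¹)
      atTop fun _ => g⁻¹ := by
    refine tendstoInMeasure_of_tendsto_ae (fun n => (hDm n).aestronglyMeasurable) ?_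
    filter_upwards [hslln] with ω hω using hω.inv₀ hg0
  have hprod := hclt.continuous_comp_prodMk_of_tendstoInMeasure_const
    (g := fun p : ℝ × ℝ => p.1 * p.2) (by fun_prop) hinv hDm
  have hRm (n : ℕ) : AEMeasurable (fun ω => √(n : ℝ) * ((∑ i ∈ Finset.range n, F i ω) /
      (∑ i ∈ Finset.range n, G i ω) - r)) P :=
    (((Finset.aemeasurable_fun_sum _ fun i _ => hFm i).div
      (Finset.aemeasurable_fun_sum _ fun i _ => hGm i)).sub_const _).const_mul _
  have hmain := tendstoInDistribution_of_tendstoInMeasure_sub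
    (fun (n : ℕ) ω => √(n : ℝ) * ((∑ i ∈ Finset.range n, F i ω) /
      (∑ i ∈ Finset.range n, G i ω) - r)) _ hprod ?_ hRm
  · -- the limit `N(0, Var W) / g` has the law asserted
    refine ⟨hmain.forall_aemeasurable, aemeasurable_id, ?_⟩
    have hlaw : (gaussianReal 0 v.toNNReal).map (id : ℝ → ℝ) =
        (gaussianReal 0 Var[W 0; P].toNNReal).map fun x => x * g⁻¹ := by
      rw [Measure.map_id, gaussianReal_map_mul_const, mul_zero]
      congr 1
      ext
      have hW : 0 ≤ Var[W 0; P] := variance_nonneg _ _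
      have hv' : v = Var[W 0; P] / g ^ 2 := hv.symm
      rw [hv', Real.coe_toNNReal _ (by positivity), NNReal.coe_mul, Real.coe_toNNReal _ hW]
      simp [div_eq_inv_mul]
    convert hmain.tendsto using 2
    exact congrArg 𝓝 (Subtype.ext hlaw)
  · refine tendstoInMeasure_of_tendsto_ae
      (fun n => ((hRm n).sub (hprod.forall_aemeasurable n)).aestronglyMeasurable) ?_
    filter_upwards [hslln] with ω hω
    refine tendsto_const_nhds.congr' ?_
    filter_upwards [hω.eventually_ne hg0, eventually_gt_atTop 0] with n hn hn0
    have hn' : (0 : ℝ) < n := by exact_mod_cast hn0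
    have hS : ∑ i ∈ Finset.range n, G i ω ≠ 0 := fun h => hn (by simp [h])
    have hsq : √(n : ℝ) ^ 2 = n := Real.sq_sqrt hn'.le
    have hs0 : √(n : ℝ) ≠ 0 := (Real.sqrt_pos.2 hn').ne'
    simp only [Pi.zero_apply, Pi.sub_apply, W, Finset.sum_sub_distrib, ← Finset.mul_sum]
    field_simp
    rw [hsq]
    ring

/-! ### Moments of `{0, 1}`-valued variables -/

section Moments

variable {Ω : Type*} [MeasurableSpace Ω] {P : Measure Ω} {Z A : Ω → ℝ}

/-- A random pair with values in the finite set `{0, 1} × {0, 1}` is bounded, and so is every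
function of it. -/
lemma memLp_two_comp_of_zero_one [IsProbabilityMeasure P] (hZ : AEMeasurable Z P)
    (hA : AEMeasurable A P)
    (hZ01 : ∀ ω, Z ω = 0 ∨ Z ω = 1) (hA01 : ∀ ω, A ω = 0 ∨ A ω = 1) {f : ℝ × ℝ → ℝ}
    (hf : Measurable f) : MemLp (fun ω => f (Z ω, A ω)) 2 P := by
  refine MemLp.of_bound (hf.comp_aemeasurable (hZ.prodMk hA)).aestronglyMeasurable
    (|f (0, 0)| + |f (0, 1)| + |f (1, 0)| + |f (1, 1)|) (ae_of_all _ fun ω => ?_)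
  have h1 := abs_nonneg (f (0, 0))
  have h2 := abs_nonneg (f (0, 1))
  have h3 := abs_nonneg (f (1, 0))
  have h4 := abs_nonneg (f (1, 1))
  rw [Real.norm_eq_abs]
  rcases hZ01 ω with hz | hz <;> rcases hA01 ω with ha | ha <;> rw [hz, ha] <;> linarith

lemma integrable_comp_of_zero_one [IsProbabilityMeasure P] (hZ : AEMeasurable Z P)
    (hA : AEMeasurable A P)
    (hZ01 : ∀ ω, Z ω = 0 ∨ Z ω = 1) (hA01 : ∀ ω, A ω = 0 ∨ A ω = 1) {f : ℝ × ℝ → ℝ}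
    (hf : Measurable f) : Integrable (fun ω => f (Z ω, A ω)) P :=
  (memLp_two_comp_of_zero_one hZ hA hZ01 hA01 hf).integrable (by norm_num)

/-- The expectation of `p Z A + q A (1 - Z) + r Z (1 - A)`. -/
lemma integral_cells [IsProbabilityMeasure P] (hZ : AEMeasurable Z P) (hA : AEMeasurable A P)
    (hZ01 : ∀ ω, Z ω = 0 ∨ Z ω = 1) (hA01 : ∀ ω, A ω = 0 ∨ A ω = 1) (p q r : ℝ) :
    ∫ ω, (p * (Z ω * A ω) + q * (A ω * (1 - Z ω)) + r * (Z ω * (1 - A ω))) ∂P =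
      p * ∫ ω, Z ω * A ω ∂P + q * ∫ ω, A ω * (1 - Z ω) ∂P + r * ∫ ω, Z ω * (1 - A ω) ∂P := by
  have h1 : Integrable (fun ω => p * (Z ω * A ω)) P :=
    integrable_comp_of_zero_one hZ hA hZ01 hA01 (f := fun y => p * (y.1 * y.2)) (by fun_prop)
  have h2 : Integrable (fun ω => q * (A ω * (1 - Z ω))) P :=
    integrable_comp_of_zero_one hZ hA hZ01 hA01 (f := fun y => q * (y.2 * (1 - y.1)))
      (by fun_prop)
  have h3 : Integrable (fun ω => r * (Z ω * (1 - A ω))) P :=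
    integrable_comp_of_zero_one hZ hA hZ01 hA01 (f := fun y => r * (y.1 * (1 - y.2)))
      (by fun_prop)
  rw [integral_add (by exact h1.add h2) h3, integral_add h1 h2, integral_const_mul,
    integral_const_mul, integral_const_mul]

lemma integral_mul_one_sub_nonneg (hZ01 : ∀ ω, Z ω = 0 ∨ Z ω = 1)
    (hA01 : ∀ ω, A ω = 0 ∨ A ω = 1) : 0 ≤ ∫ ω, Z ω * (1 - A ω) ∂P :=
  integral_nonneg fun ω => by
    rcases hZ01 ω with hz | hz <;> rcases hA01 ω with ha | ha <;> simp [hz, ha]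

lemma integral_eq_add_of_zero_one [IsProbabilityMeasure P] (hZ : AEMeasurable Z P)
    (hA : AEMeasurable A P)
    (hZ01 : ∀ ω, Z ω = 0 ∨ Z ω = 1) (hA01 : ∀ ω, A ω = 0 ∨ A ω = 1) :
    ∫ ω, Z ω ∂P = ∫ ω, Z ω * A ω ∂P + ∫ ω, Z ω * (1 - A ω) ∂P := by
  have := integral_cells (P := P) hZ hA hZ01 hA01 1 0 1
  simp only [one_mul, zero_mul, add_zero] at this
  rw [← this]
  congr 1; ext ω; ring

lemma measureReal_eq_one_of_zero_one (hZ : Measurable Z) (hZ01 : ∀ ω, Z ω = 0 ∨ Z ω = 1) :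
    P.real {ω | Z ω = 1} = ∫ ω, Z ω ∂P := by
  have hm : MeasurableSet {ω | Z ω = 1} := hZ (measurableSet_singleton 1)
  rw [← integral_indicator_one hm]
  congr 1; ext ω
  rcases hZ01 ω with hz | hz <;> simp [Set.indicator, hz]

lemma cond_real_eq_of_zero_one [IsProbabilityMeasure P] (hZ : Measurable Z) (hA : Measurable A)
    (hZ01 : ∀ ω, Z ω = 0 ∨ Z ω = 1) (hA01 : ∀ ω, A ω = 0 ∨ A ω = 1) :
    (cond P {ω | A ω = 1}).real {ω | Z ω = 1} = (∫ ω, Z ω * A ω ∂P) / ∫ ω, A ω ∂P := by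
  have hm : MeasurableSet {ω | A ω = 1} := hA (measurableSet_singleton 1)
  rw [measureReal_def, cond_apply hm, ENNReal.toReal_mul, ENNReal.toReal_inv, ← measureReal_def,
    ← measureReal_def, measureReal_eq_one_of_zero_one hA hA01,
    ← measureReal_eq_one_of_zero_one (Z := fun ω => Z ω * A ω) (hZ.mul hA), div_eq_inv_mul]
  · congr 2; ext ω
    rcases hZ01 ω with hz | hz <;> rcases hA01 ω with ha | ha <;> simp [hz, ha]
  · intro ω
    rcases hZ01 ω with hz | hz <;> rcases hA01 ω with ha | ha <;> simp [hz, ha]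

/-! ### The F-beta measure, the asymptotic variance and its bound -/

lemma fBeta_eq_tverskyIndex [IsProbabilityMeasure P] (hZ : Measurable Z) (hA : Measurable A)
    (hZ01 : ∀ ω, Z ω = 0 ∨ Z ω = 1) (hA01 : ∀ ω, A ω = 0 ∨ A ω = 1)
    (hZA : 0 < ∫ ω, Z ω * A ω ∂P) (β : ℝ) :
    fBeta P Z A β = tverskyIndex P Z A (1 / (1 + β ^ 2)) (β ^ 2 / (1 + β ^ 2)) := by
  have hprec := cond_real_eq_of_zero_one (P := P) hZ hA hZ01 hA01
  have hrec := cond_real_eq_of_zero_one (P := P) hA hZ hA01 hZ01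
  have hEZ := integral_eq_add_of_zero_one (P := P) hZ.aemeasurable hA.aemeasurable hZ01 hA01
  have hEA := integral_eq_add_of_zero_one (P := P) hA.aemeasurable hZ.aemeasurable hA01 hZ01
  have hu := integral_mul_one_sub_nonneg (P := P) hA01 hZ01
  have hv := integral_mul_one_sub_nonneg (P := P) hZ01 hA01
  have hcomm : ∫ ω, A ω * Z ω ∂P = ∫ ω, Z ω * A ω ∂P := by simp_rw [mul_comm]
  rw [hcomm] at hrec hEA
  rw [fBeta, precision, recallRate, hprec, hrec, hEZ, hEA, tverskyIndex, tverskyRatio]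
  generalize ∫ ω, Z ω * A ω ∂P = x at *
  generalize ∫ ω, A ω * (1 - Z ω) ∂P = u at *
  generalize ∫ ω, Z ω * (1 - A ω) ∂P = v at *
  have h1 : 0 < 1 + β ^ 2 := by positivity
  have h2 : 0 < x + u + β ^ 2 * (x + v) := by positivity
  have h3 : 0 < x * (1 + β ^ 2) + u + β ^ 2 * v := by positivity
  field_simp
  ring

/-- `ν(a, b)` with denominators cleared, in terms of `x = E(ZA)`, `u = E(A(1 - Z))` and
`v = E(Z(1 - A))`. -/
lemma tverskyVariance_eq (hZA : 0 < ∫ ω, Z ω * A ω ∂P) (a b : ℝ)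
    {x u v : ℝ} (hx : ∫ ω, Z ω * A ω ∂P = x) (hu : ∫ ω, A ω * (1 - Z ω) ∂P = u)
    (hv : ∫ ω, Z ω * (1 - A ω) ∂P = v) :
    tverskyVariance P Z A a b =
      x * ((a ^ 2 * u + b ^ 2 * v) * x + (a * u + b * v) ^ 2) / (x + a * u + b * v) ^ 4 := by
  subst hx hu hv
  simp only [tverskyVariance, tverskyIndex, tverskyRatio, inv_div]
  generalize ∫ ω, Z ω * A ω ∂P = x at *
  generalize ∫ ω, A ω * (1 - Z ω) ∂P = u at *
  generalize ∫ ω, Z ω * (1 - A ω) ∂P = v at *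
  rcases eq_or_ne (x + a * u + b * v) 0 with h | h
  · simp [h]
  · field_simp
    ring

lemma tverskyVariance_nonneg (hZ01 : ∀ ω, Z ω = 0 ∨ Z ω = 1) (hA01 : ∀ ω, A ω = 0 ∨ A ω = 1)
    (hZA : 0 < ∫ ω, Z ω * A ω ∂P) (a b : ℝ) : 0 ≤ tverskyVariance P Z A a b := by
  have hu := integral_mul_one_sub_nonneg (P := P) hA01 hZ01
  have hv := integral_mul_one_sub_nonneg (P := P) hZ01 hA01
  rw [tverskyVariance_eq hZA a b rfl rfl rfl]
  positivity

/-- The bound on `ν(a, b)`. With `s = a u + b v` and `m = max a b`, the estimate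
`a² u + b² v ≤ m s` bounds `ν(a, b)` by `τ (1 - τ) (1 - (1 - m) τ) · τ / x`, and the inequality
`b EZ = b (x + v) ≤ s + m x` turns `τ / x` into `(1 - (1 - m) τ) / (b EZ)`. -/
lemma tverskyVariance_le [IsProbabilityMeasure P] (hZ : AEMeasurable Z P) (hA : AEMeasurable A P)
    (hZ01 : ∀ ω, Z ω = 0 ∨ Z ω = 1) (hA01 : ∀ ω, A ω = 0 ∨ A ω = 1)
    (hZA : 0 < ∫ ω, Z ω * A ω ∂P) {a b : ℝ} (ha : 0 < a) (hb : 0 < b) :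
    tverskyVariance P Z A a b ≤ boundV (max a b) / (b * ∫ ω, Z ω ∂P) := by
  have hu := integral_mul_one_sub_nonneg (P := P) hA01 hZ01
  have hv := integral_mul_one_sub_nonneg (P := P) hZ01 hA01
  rw [tverskyVariance_eq hZA a b rfl rfl rfl, integral_eq_add_of_zero_one hZ hA hZ01 hA01]
  generalize ∫ ω, Z ω * A ω ∂P = x at *
  generalize ∫ ω, A ω * (1 - Z ω) ∂P = u at *
  generalize ∫ ω, Z ω * (1 - A ω) ∂P = v at *
  have ham := le_max_left a b
  have hbm := le_max_right a b
  generalize max a b = m at *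
  have hau : 0 ≤ a * u := by positivity
  have hbv : 0 ≤ b * v := by positivity
  have hs : 0 ≤ a * u + b * v := by positivity
  have hD : 0 < x + a * u + b * v := by positivity
  have hτ : x / (x + a * u + b * v) ∈ Set.Icc (0 : ℝ) 1 :=
    ⟨by positivity, (div_le_one hD).2 (by linarith)⟩
  have hmax : boundFun m (x / (x + a * u + b * v)) ≤ boundV m :=
    isMaxOn_boundFun_tauOpt (ha.trans_le ham) hτ
  refine le_trans ?_ (div_le_div_of_nonneg_right hmax (by positivity))
  have hf : boundFun m (x / (x + a * u + b * v)) =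
      x * (a * u + b * v) * (a * u + b * v + m * x) ^ 2 / (x + a * u + b * v) ^ 4 := by
    rw [boundFun_eq]
    field_simp
    ring
  rw [hf, div_right_comm]
  refine div_le_div_of_nonneg_right ?_ (by positivity)
  rw [le_div_iff₀ (by positivity)]
  have h1 : a ^ 2 * u + b ^ 2 * v ≤ m * (a * u + b * v) := by
    linarith [mul_le_mul_of_nonneg_right ham hau, mul_le_mul_of_nonneg_right hbm hbv]
  have h2 : b * (x + v) ≤ a * u + b * v + m * x := by
    linarith [mul_le_mul_of_nonneg_right hbm hZA.le]
  have hm : 0 < m := ha.trans_le ham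
  calc x * ((a ^ 2 * u + b ^ 2 * v) * x + (a * u + b * v) ^ 2) * (b * (x + v))
      ≤ x * (m * (a * u + b * v) * x + (a * u + b * v) ^ 2) * (a * u + b * v + m * x) := by
        gcongr
    _ = x * (a * u + b * v) * (a * u + b * v + m * x) ^ 2 := by ring

/-- `ν(a, b)` is the asymptotic variance of the ratio `τ_n(a, b)` given by the delta method. -/
lemma variance_div_sq_eq_tverskyVariance [IsProbabilityMeasure P] (hZ : AEMeasurable Z P)
    (hA : AEMeasurable A P)
    (hZ01 : ∀ ω, Z ω = 0 ∨ Z ω = 1) (hA01 : ∀ ω, A ω = 0 ∨ A ω = 1)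
    (hZA : 0 < ∫ ω, Z ω * A ω ∂P) {a b x u v D : ℝ} (ha : 0 < a) (hb : 0 < b)
    (hx : ∫ ω, Z ω * A ω ∂P = x) (hu : ∫ ω, A ω * (1 - Z ω) ∂P = u)
    (hv : ∫ ω, Z ω * (1 - A ω) ∂P = v) (hD : D = x + a * u + b * v) :
    Var[fun ω => Z ω * A ω -
        x / D * (Z ω * A ω + a * (A ω * (1 - Z ω)) + b * (Z ω * (1 - A ω))); P] / D ^ 2 =
      tverskyVariance P Z A a b := by
  have hu0 := integral_mul_one_sub_nonneg (P := P) hA01 hZ01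
  have hv0 := integral_mul_one_sub_nonneg (P := P) hZ01 hA01
  rw [tverskyVariance_eq hZA a b hx hu hv]
  have hm1 := integral_cells (P := P) hZ hA hZ01 hA01 (1 - x / D) (-(x / D * a)) (-(x / D * b))
  have hm2 := integral_cells (P := P) hZ hA hZ01 hA01 ((1 - x / D) ^ 2) ((x / D * a) ^ 2)
    ((x / D * b) ^ 2)
  rw [hx, hu, hv] at hm1 hm2
  rw [hx] at hZA
  rw [hu] at hu0
  rw [hv] at hv0
  have hD0 : 0 < D := by rw [hD]; positivity
  have hmem := memLp_two_comp_of_zero_one hZ hA hZ01 hA01 (f := fun p => p.1 * p.2 -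
    x / D * (p.1 * p.2 + a * (p.2 * (1 - p.1)) + b * (p.1 * (1 - p.2)))) (by fun_prop)
  have e1 : ∫ ω, (Z ω * A ω -
      x / D * (Z ω * A ω + a * (A ω * (1 - Z ω)) + b * (Z ω * (1 - A ω)))) ∂P = 0 := by
    trans (1 - x / D) * x + -(x / D * a) * u + -(x / D * b) * v
    · rw [← hm1]
      congr 1; ext ω; ring
    · field_simp
      rw [hD]; ring
  -- the three events are disjoint, so that squaring acts on the coefficients
  have e2 : ∫ ω, (Z ω * A ω -
      x / D * (Z ω * A ω + a * (A ω * (1 - Z ω)) + b * (Z ω * (1 - A ω)))) ^ 2 ∂P =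
        (1 - x / D) ^ 2 * x + (x / D * a) ^ 2 * u + (x / D * b) ^ 2 * v := by
    rw [← hm2]
    congr 1; ext ω
    rcases hZ01 ω with hz | hz <;> rcases hA01 ω with h | h <;> simp [hz, h]
  rw [variance_of_integral_eq_zero hmem.aestronglyMeasurable.aemeasurable e1, e2, ← hD]
  have hs : a * u + b * v = D - x := by rw [hD]; ring
  rw [hs]
  field_simp
  ring

end Moments

/-! ### Asymptotic normality of the empirical Tversky index -/

lemma empiricalTversky_eq {Ω : Type*} (Zs As : ℕ → Ω → ℝ) (a b : ℝ) (n : ℕ) (ω : Ω) :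
    empiricalTversky Zs As a b n ω = (∑ i ∈ Finset.range n, Zs i ω * As i ω) /
      ∑ i ∈ Finset.range n, (Zs i ω * As i ω + a * (As i ω * (1 - Zs i ω)) +
        b * (Zs i ω * (1 - As i ω))) := by
  simp only [empiricalTversky, tverskyRatio, sampleMean, Finset.sum_add_distrib, ← Finset.mul_sum]
  rcases Nat.eq_zero_or_pos n with rfl | hn
  · simp
  have hn' : (n : ℝ)⁻¹ ≠ 0 := by positivity
  symm
  rw [← mul_div_mul_left _ _ hn']
  simp only [mul_add, mul_left_comm]

theorem tendstoInDistribution_empiricalTversky {Ω : Type*} [MeasurableSpace Ω] {P : Measure Ω}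
    [IsProbabilityMeasure P] {Z A : Ω → ℝ} {Zs As : ℕ → Ω → ℝ}
    (hZ01 : ∀ ω, Z ω = 0 ∨ Z ω = 1) (hA01 : ∀ ω, A ω = 0 ∨ A ω = 1)
    (hZs01 : ∀ i ω, Zs i ω = 0 ∨ Zs i ω = 1) (hAs01 : ∀ i ω, As i ω = 0 ∨ As i ω = 1)
    (hindep : iIndepFun (fun i ω => (Zs i ω, As i ω)) P)
    (hident : ∀ i, IdentDistrib (fun ω => (Zs i ω, As i ω)) (fun ω => (Z ω, A ω)) P P)
    (hZA : 0 < ∫ ω, Z ω * A ω ∂P) {a b : ℝ} (ha : 0 < a) (hb : 0 < b) :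
    TendstoInDistribution
      (fun (n : ℕ) ω => √(n : ℝ) * (empiricalTversky Zs As a b n ω - tverskyIndex P Z A a b))
      atTop (id : ℝ → ℝ) (fun _ => P)
      (gaussianReal 0 (tverskyVariance P Z A a b).toNNReal) := by
  have hZ : AEMeasurable Z P := ((hident 0).comp measurable_fst).aemeasurable_snd
  have hA : AEMeasurable A P := ((hident 0).comp measurable_snd).aemeasurable_snd
  have hZs : AEMeasurable (Zs 0) P := ((hident 0).comp measurable_fst).aemeasurable_fst
  have hAs : AEMeasurable (As 0) P := ((hident 0).comp measurable_snd).aemeasurable_fst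
  let f : ℝ × ℝ → ℝ := fun p => p.1 * p.2
  let g : ℝ × ℝ → ℝ := fun p => p.1 * p.2 + a * (p.2 * (1 - p.1)) + b * (p.1 * (1 - p.2))
  have hf : Measurable f := by fun_prop
  have hg : Measurable g := by fun_prop
  have hEf : ∫ ω, f (Zs 0 ω, As 0 ω) ∂P = ∫ ω, Z ω * A ω ∂P := ((hident 0).comp hf).integral_eq
  have hEg : ∫ ω, g (Zs 0 ω, As 0 ω) ∂P = ∫ ω, Z ω * A ω ∂P +
      a * ∫ ω, A ω * (1 - Z ω) ∂P + b * ∫ ω, Z ω * (1 - A ω) ∂P := by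
    have h1 : ∫ ω, g (Zs 0 ω, As 0 ω) ∂P = ∫ ω, g (Z ω, A ω) ∂P :=
      ((hident 0).comp hg).integral_eq
    have h2 := integral_cells (P := P) hZ hA hZ01 hA01 1 a b
    simp only [one_mul] at h2
    exact h1.trans h2
  have hu := integral_mul_one_sub_nonneg (P := P) hA01 hZ01
  have hv := integral_mul_one_sub_nonneg (P := P) hZ01 hA01
  have hE0 : ∫ ω, Z ω * A ω ∂P + a * ∫ ω, A ω * (1 - Z ω) ∂P +
      b * ∫ ω, Z ω * (1 - A ω) ∂P ≠ 0 := by positivity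
  have key := tendstoInDistribution_sqrt_mul_ratio_sub (P := P)
    (F := fun i ω => f (Zs i ω, As i ω)) (G := fun i ω => g (Zs i ω, As i ω))
    (memLp_two_comp_of_zero_one hZs hAs (hZs01 0) (hAs01 0) hf)
    (memLp_two_comp_of_zero_one hZs hAs (hZs01 0) (hAs01 0) hg)
    (hindep.comp (fun _ p => (f p, g p)) fun _ => hf.prodMk hg)
    (fun i => ((hident i).trans (hident 0).symm).comp (hf.prodMk hg)) hEf hEg hE0
    ((congrArg (· / _ ^ 2) ((hident 0).comp
      (u := fun p => f p - _ / _ * g p) (by fun_prop)).variance_eq).trans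
      (variance_div_sq_eq_tverskyVariance hZ hA hZ01 hA01 hZA ha hb rfl rfl rfl rfl))
  simpa only [empiricalTversky_eq, tverskyIndex, tverskyRatio, f, g] using key

theorem mainTheorem1 {Ω : Type*} [MeasurableSpace Ω] (P : Measure Ω) [IsProbabilityMeasure P]
    (Z A : Ω → ℝ) (Zs As : ℕ → Ω → ℝ)
    (hZ : Measurable Z) (hA : Measurable A)
    (hZ01 : ∀ ω, Z ω = 0 ∨ Z ω = 1) (hA01 : ∀ ω, A ω = 0 ∨ A ω = 1)
    (hZs01 : ∀ i ω, Zs i ω = 0 ∨ Zs i ω = 1) (hAs01 : ∀ i ω, As i ω = 0 ∨ As i ω = 1)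
    (hindep : iIndepFun (fun i ω => (Zs i ω, As i ω)) P)
    (hident : ∀ i, IdentDistrib (fun ω => (Zs i ω, As i ω)) (fun ω => (Z ω, A ω)) P P)
    (hZA : 0 < ∫ ω, Z ω * A ω ∂P)
    (a b : ℝ) (ha : 0 < a) (hb : 0 < b) :
    -- the F-beta measure is a Tversky index
    (∀ β : ℝ, 0 < β →
      fBeta P Z A β = tverskyIndex P Z A (1 / (1 + β ^ 2)) (β ^ 2 / (1 + β ^ 2))) ∧
    -- (i) asymptotic normality
    (0 ≤ tverskyVariance P Z A a b ∧
      TendstoInDistribution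
        (fun (n : ℕ) ω => √(n : ℝ) * (empiricalTversky Zs As a b n ω - tverskyIndex P Z A a b))
        atTop (id : ℝ → ℝ) (fun _ => P)
        (gaussianReal 0 (tverskyVariance P Z A a b).toNNReal)) ∧
    -- (ii) a common bound for all prediction rules, and `V` as a maximum attained at `τ_o`
    ((∀ A' : Ω → ℝ, Measurable A' → (∀ ω, A' ω = 0 ∨ A' ω = 1) → 0 < ∫ ω, Z ω * A' ω ∂P →
        tverskyVariance P Z A' a b ≤ boundV (max a b) / (b * ∫ ω, Z ω ∂P)) ∧
      tauOpt (max a b) ∈ Set.Ioo (0 : ℝ) 1 ∧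
      IsMaxOn (boundFun (max a b)) (Set.Icc 0 1) (tauOpt (max a b))) ∧
    -- (iii) values of `V`, rounded to four decimals
    (|boundV 0.5 - 0.1549| ≤ 0.00005 ∧ |boundV 0.6 - 0.1695| ≤ 0.00005 ∧
      |boundV 0.7 - 0.1861| ≤ 0.00005 ∧ |boundV 0.8 - 0.2050| ≤ 0.00005 ∧
      |boundV 0.9 - 0.2262| ≤ 0.00005) := by
  have hm : 0 < max a b := lt_max_of_lt_left ha
  exact ⟨fun β _ => fBeta_eq_tverskyIndex hZ hA hZ01 hA01 hZA β,
    ⟨tverskyVariance_nonneg hZ01 hA01 hZA a b,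
      tendstoInDistribution_empiricalTversky hZ01 hA01 hZs01 hAs01 hindep hident hZA ha hb⟩,
    ⟨fun A' hA' hA'01 hZA' =>
        tverskyVariance_le hZ.aemeasurable hA'.aemeasurable hZ01 hA'01 hZA' ha hb,
      (tauOpt_spec hm).1, isMaxOn_boundFun_tauOpt hm⟩,
    abs_boundV_half_sub_le, abs_boundV_three_fifths_sub_le, abs_boundV_seven_tenths_sub_le,
    abs_boundV_four_fifths_sub_le, abs_boundV_nine_tenths_sub_le⟩
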